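/- Recall that a nilspace is a set $X$ with sets $C^n(X)\subset X^{\{0,1\}^n}$ of $n$-cubes, $n\geq 0$, such that (composition) $q\circ\phi\in C^m(X)$ whenever $q\in C^n(X)$ and $\phi:\{0,1\}^m\to\{0,1\}^n$ is the restriction of an affine homomorphism $\mathbb Z^m\to\mathbb Z^n$; (ergodicity) $C^1(X)=X^{\{0,1\}}$; (corner completion) for $n\ge1$, every $n$-corner, i.e. map $q':\{0,1\}^n\setminus\{1^n\}\to X$ whose restriction to each $(n-1)$-face containing $0^n$ is in $C^{n-1}(X)$, extends to some $q\in C^n(X)$. It is $k$-step if every $(k+1)$-corner has exactly one such extension. Let $k\ge 1$ and $i\ge 1$ be integers, let $X$ be a $k$-step nilspace with cube sets $C^n(X)\subset X^{\{0,1\}^n}$ ($n\geq 0$), and let $\mathcal F_{k-1}(X)=X/\!\sim_{k-1}$ with projection $\pi_{k-1}:X\to\mathcal F_{k-1}(X)$ and the quotient cube structure $C^n(\mathcal F_{k-1}(X))=\{\pi_{k-1}\circ q: q\in C^n(X)\}$; here, on any space with cube sets, $x\sim_{k-1}y$ means that there are two $k$-cubes with values $x$ and $y$ respectively at $0^k$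 which agree at every other vertex of $\{0,1\}^k$. A translation of height $i$ on a nilspace $Y$ is a map $\alpha:Y\to Y$ such that for every $n\geq i$, every face $F\subset\{0,1\}^n$ of codimension $i$ and every $q\in C^n(Y)$, the map equal to $\alpha\circ q$ on $F$ and to $q$ off $F$ is in $C^n(Y)$. Let $\alpha$ be a translation of height $i$ on $\mathcal F_{k-1}(X)$. Let $$\mathcal T=\{(x_0,x_1)\in X^2:\alpha(\pi_{k-1}(x_0))=\pi_{k-1}(x_1)\},$$ where $q_0\times q_1:\{0,1\}^n\to\mathcal T$ is declared to be an $n$-cube if the $i$-arrow $\{0,1\}^{n+i}\to X$, sending $(v,w)$ to $q_1(v)$ if $w=1^i$ and to $q_0(v)$ otherwise, is in $C^{n+i}(X)$. Let $\mathcal T^*=\mathcal T^*(\alpha,X,i)=\mathcal F_{k-1}(\mathcal T)$ be the quotient of $\mathcal T$ by (the equivalence relation generated by) its relation $\sim_{k-1}$, with the quotient cube structure, and let $\gamma:\mathcal T^*\to\mathcal F_{k-1}(X)$ be the map sending the class of $(x_0,x_1)$ to $\pi_{k-1}(x_0)$. Suppose that $\mathcal T^*$ is split over $\mathcal F_{k-1}(X)$,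 that is, there is a cube-preserving map $m:\mathcal F_{k-1}(X)\to\mathcal T^*$ such that $\gamma\circ m$ is the identity. Then $\alpha$ lifts to a translation of height $i$ on $X$: there is a translation $\beta$ of height $i$ on $X$ such that $\pi_{k-1}(\beta(x))=\alpha(\pi_{k-1}(x))$ for every $x\in X$. -/

import Mathlib

/-! ### Discrete cubes -/

/-- The discrete cube `{0,1}^n`; `false` stands for `0` and `true` for `1`. -/
abbrev DCube (n : ℕ) : Type := Fin n → Bool

namespace DCube

/-- The vertex `0^n`. -/
def zero (n : ℕ) : DCube n := fun _ => false

/-- The vertex `1^n`. -/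
def one (n : ℕ) : DCube n := fun _ => true

/-- The inclusion of `{0,1}^n` in `ℤ^n`. -/
def toInt {n : ℕ} (v : DCube n) : Fin n → ℤ := fun j => if v j = true then 1 else 0

/-- Discrete-cube morphisms: restrictions of affine homomorphisms `ℤ^m → ℤ^n`. -/
def IsMorphism {m n : ℕ} (φ : DCube m → DCube n) : Prop :=
  ∃ (f : (Fin m → ℤ) →+ (Fin n → ℤ)) (t : Fin n → ℤ), ∀ v, toInt (φ v) = f (toInt v) + t

/-- The face of `{0,1}^n` obtained by fixing the coordinates in `I` to be those of `x`.
Its codimension is the cardinality of `I`. -/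
def face {n : ℕ} (I : Finset (Fin n)) (x : DCube n) : Set (DCube n) :=
  {v | ∀ j ∈ I, v j = x j}

end DCube

/-! ### Cube structures and nilspaces -/

/-- A choice of a set `C n` of maps `{0,1}^n → X` (the `n`-cubes) for every `n ≥ 0`. -/
abbrev CubeFamily (X : Type*) : Type _ := (n : ℕ) → Set (DCube n → X)

/-- `q` is an `(n+1)`-corner: its restriction to every `n`-face containing `0^{n+1}`, that is, to
every face `{v | v j = 0}`, is an `n`-cube. The value of `q` at `1^{n+1}` plays no role: the corner
is the restriction of `q` to `{0,1}^{n+1} \ {1^{n+1}}`. (As this set is non-empty, every map on it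
is such a restriction.) -/
def IsCubeCorner {X : Type*} (C : CubeFamily X) (n : ℕ) (q : DCube (n + 1) → X) : Prop :=
  ∀ j : Fin (n + 1), (fun u : DCube n => q (j.insertNth (α := fun _ => Bool) false u)) ∈ C n

/-- `c` is an `(n+1)`-cube that agrees with `q` away from `1^{n+1}`. -/
def IsCubeCompletion {X : Type*} (C : CubeFamily X) (n : ℕ) (q c : DCube (n + 1) → X) : Prop :=
  c ∈ C (n + 1) ∧ ∀ v, v ≠ DCube.one (n + 1) → c v = q v

/-- Nilspaces. The empty nilspace is allowed. -/
structure IsNilspace {X : Type*} (C : CubeFamily X) : Prop where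
  composition : ∀ (m n : ℕ) (φ : DCube m → DCube n), DCube.IsMorphism φ →
    ∀ q ∈ C n, q ∘ φ ∈ C m
  ergodicity : C 1 = Set.univ
  corner_completion : ∀ (n : ℕ) (q : DCube (n + 1) → X), IsCubeCorner C n q →
    ∃ c, IsCubeCompletion C n q c

/-- `k`-step nilspaces: every `(k+1)`-corner has a unique completion. -/
structure IsStepNilspace {X : Type*} (C : CubeFamily X) (k : ℕ) : Prop
    extends IsNilspace C where
  unique_completion : ∀ q : DCube (k + 1) → X, IsCubeCorner C k q → ∃! c, IsCubeCompletion C k q c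

/-- Cube-preserving maps. -/
def IsCubeMorphism {X Y : Type*} (C : CubeFamily X) (D : CubeFamily Y) (g : X → Y) : Prop :=
  ∀ (n : ℕ), ∀ q ∈ C n, g ∘ q ∈ D n

/-! ### Subspaces and characteristic factors -/

/-- The cubes of `C` that take values in the subset `S`. -/
def subCubes {X : Type*} (C : CubeFamily X) (S : Set X) : CubeFamily S :=
  fun n => {q | Subtype.val ∘ q ∈ C n}

/-- The relation `∼_s`: there are two `(s+1)`-cubes with values `x`, `y` at `0^{s+1}` that agree
at all other vertices. -/
def charRel {X : Type*} (C : CubeFamily X) (s : ℕ) (x y : X) : Prop :=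
  ∃ q₀ ∈ C (s + 1), ∃ q₁ ∈ C (s + 1),
    q₀ (DCube.zero (s + 1)) = x ∧ q₁ (DCube.zero (s + 1)) = y ∧
      ∀ v, v ≠ DCube.zero (s + 1) → q₀ v = q₁ v

/-- The underlying set of the factor `F_s(X)`, the quotient of `X` by `∼_s`. (On a nilspace `∼_s`
is an equivalence relation; in general `Quot` is the quotient by the equivalence relation that it
generates.) -/
def Factor {X : Type*} (C : CubeFamily X) (s : ℕ) : Type _ := Quot (charRel C s)

/-- The canonical projection `π_s : X → F_s(X)`. -/
def factorProj {X : Type*} (C : CubeFamily X) (s : ℕ) : X → Factor C s := Quot.mk (charRel C s)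

/-- The quotient cube structure on `F_s(X)`: the cubes are the maps `π_s ∘ q`, `q` a cube. -/
def factorCubes {X : Type*} (C : CubeFamily X) (s : ℕ) : CubeFamily (Factor C s) :=
  fun n => {q | ∃ c ∈ C n, q = factorProj C s ∘ c}

/-! ### Arrow spaces and translations -/

open Classical in
/-- The `i`-arrow `⟨q₀, q₁⟩_i` of two maps on `{0,1}^n`: the map on `{0,1}^{n+i}` sending `(v, w)`
to `q₁ v` if `w = 1^i`, and to `q₀ v` otherwise. -/
noncomputable def arrow {X : Type*} {n : ℕ} (i : ℕ) (q₀ q₁ : DCube n → X) : DCube (n + i) → X :=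
  fun u => if (fun j : Fin i => u (Fin.natAdd n j)) = DCube.one i
    then q₁ (fun j => u (Fin.castAdd i j))
    else q₀ (fun j => u (Fin.castAdd i j))

/-- The cubes of the `i`-th arrow space `X ⋈_i X`. -/
def arrowCubes {X : Type*} (C : CubeFamily X) (i : ℕ) : CubeFamily (X × X) :=
  fun n => {q | arrow i (Prod.fst ∘ q) (Prod.snd ∘ q) ∈ C (n + i)}

open Classical in
/-- The map `α^F`: apply `α` to the values of `f` at the points of `F`. -/
noncomputable def applyOn {X : Type*} {n : ℕ} (α : X → X) (F : Set (DCube n)) (f : DCube n → X) :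
    DCube n → X :=
  fun v => if v ∈ F then α (f v) else f v

/-- Translations of height `i`: for every face `F` of codimension `i` of a cube `{0,1}^n`, the map
`α^F` preserves `n`-cubes. -/
def IsTranslation {X : Type*} (C : CubeFamily X) (i : ℕ) (α : X → X) : Prop :=
  ∀ (n : ℕ) (I : Finset (Fin n)) (x : DCube n), I.card = i →
    ∀ q ∈ C n, applyOn α (DCube.face I x) q ∈ C n

/-- `β` is a lift of `α` (a translation of height `i` on `F_s(X)`) to a translation of height `i`
on `X`. -/
def IsTranslationLift {X : Type*} (C : CubeFamily X) (s i : ℕ)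
    (α : Factor C s → Factor C s) (β : X → X) : Prop :=
  IsTranslation C i β ∧ ∀ x, factorProj C s (β x) = α (factorProj C s x)

/-! ### Translation bundles -/

/-- The set `T(α, X, i)` of pairs `(x₀, x₁)` with `α (π_s x₀) = π_s x₁`. -/
def transPairs {X : Type*} (C : CubeFamily X) (s : ℕ) (α : Factor C s → Factor C s) :
    Set (X × X) :=
  {p | α (factorProj C s p.1) = factorProj C s p.2}

/-- The cubes on `T(α, X, i)`: those of the arrow space `X ⋈_i X` with values in this set. -/
def transPairsCubes {X : Type*} (C : CubeFamily X) (s i : ℕ) (α : Factor C s → Factor C s) :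
    CubeFamily (transPairs C s α) :=
  subCubes (arrowCubes C i) (transPairs C s α)

/-- The underlying set of the translation bundle `T^*(α, X, i) = F_s(T(α, X, i))`. -/
abbrev TransBundle {X : Type*} (C : CubeFamily X) (s i : ℕ) (α : Factor C s → Factor C s) :
    Type _ :=
  Factor (transPairsCubes C s i α) s

/-- The cubes on `T^*(α, X, i)`. -/
abbrev transBundleCubes {X : Type*} (C : CubeFamily X) (s i : ℕ)
    (α : Factor C s → Factor C s) : CubeFamily (TransBundle C s i α) :=
  factorCubes (transPairsCubes C s i α) s

/-- For `i ≥ 1`, the first component of a cube on an `i`-th arrow space is a cube. -/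
theorem fst_mem_of_mem_arrowCubes {X : Type*} {C : CubeFamily X} (hC : IsNilspace C) {i : ℕ}
    (hi : 1 ≤ i) {n : ℕ} {q : DCube n → X × X} (hq : q ∈ arrowCubes C i n) :
    Prod.fst ∘ q ∈ C n := by
  have hm : DCube.IsMorphism
      (fun v : DCube n => (Fin.append v (DCube.zero i) : DCube (n + i))) := by
    refine ⟨⟨⟨fun z => Fin.append z 0, ?_⟩, ?_⟩, 0, ?_⟩
    · ext j
      refine Fin.addCases (fun j => ?_) (fun j => ?_) j <;> simp
    · intro a b
      ext j
      refine Fin.addCases (fun j => ?_) (fun j => ?_) j <;> simp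
    · intro v
      ext j
      refine Fin.addCases (fun j => ?_) (fun j => ?_) j <;> simp [DCube.toInt, DCube.zero]
  have h := hC.composition _ _ _ hm _ hq
  have e : arrow i (Prod.fst ∘ q) (Prod.snd ∘ q) ∘
      (fun v : DCube n => (Fin.append v (DCube.zero i) : DCube (n + i))) = Prod.fst ∘ q := by
    funext v
    have hne : ¬ (DCube.zero i = DCube.one i) := fun h0 => by
      have := congrFun h0 ⟨0, hi⟩
      simp [DCube.zero, DCube.one] at this
    have h1 : (fun j : Fin i => (Fin.append v (DCube.zero i) : DCube (n + i)) (Fin.natAdd n j)) =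
        DCube.zero i := by
      funext j
      simp
    have h2 : (fun j : Fin n => (Fin.append v (DCube.zero i) : DCube (n + i)) (Fin.castAdd i j)) =
        v := by
      funext j
      simp
    simp only [Function.comp_apply, arrow, h1, h2, if_neg hne]
  rwa [e] at h

/-- The bundle map `γ : T^*(α, X, i) → F_s(X)` sending the class of `(x₀, x₁)` to `π_s x₀`. -/
def transBundleMap {X : Type*} (C : CubeFamily X) (hC : IsNilspace C) (s i : ℕ) (hi : 1 ≤ i)
    (α : Factor C s → Factor C s) : TransBundle C s i α → Factor C s :=
  Quot.lift (fun p => factorProj C s p.1.1) (by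
    rintro p p' ⟨q₀, h₀, q₁, h₁, rfl, rfl, h⟩
    refine Quot.sound ⟨_, fst_mem_of_mem_arrowCubes hC hi h₀, _,
      fst_mem_of_mem_arrowCubes hC hi h₁, rfl, rfl, fun v hv => ?_⟩
    simp only [Function.comp_apply, h v hv])

/-- A projection `π : Y → X` (the bundle map of an extension) is split if it has a cube-preserving
section. -/
def IsSplitProj {X Y : Type*} (C : CubeFamily X) (D : CubeFamily Y) (π : Y → X) : Prop :=
  ∃ m : X → Y, IsCubeMorphism C D m ∧ π ∘ m = id

/-! Write `k = s + 1`. The fibres of `π_s` behave like torsors under one abelian group. The group is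
never built: `Parallel` expresses directly that two pairs of points in fibres have the same
difference.

The section `m` picks over each `y` a class with a representative `(a, b)`, where `a` lies over `y`.
For `x` over `y`, let `β x` be `b` displaced by the difference from `a` to `x` (`Parallel.exists`).
Equivalent pairs of `T` differ by the same displacement in both components
(`Parallel.of_factorProj_transPairs_eq`), so any representative of the class has this relation to
`x` and `β x`.

Given a cube `c` of `X`, the cube `m ∘ π_s ∘ c` comes from a cube `r` of `T`. The arrow of `c` and
`β ∘ c` is the arrow of `r`, displaced at each vertex by the difference from `r.1` to `c`.
Displacing a cube by the difference of two cubes gives a cube (`Parallel.isCubeOn`), so the new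
arrow is a cube, and this makes `β` a translation (`IsNilspace.isTranslation_of_arrow`).

The calculus of displacements rests on one gluing lemma, `IsNilspace.isCubeOn_replace`. -/

/-! ### Cubes indexed by arbitrary finite sets -/

/-- A Boolean function of the form `b`, `u i` or `!u i`. -/
def IsLiteral {ι : Type*} (g : (ι → Bool) → Bool) : Prop :=
  (∃ b, ∀ u, g u = b) ∨ (∃ i, ∀ u, g u = u i) ∨ ∃ i, ∀ u, g u = !u i

/-- A map between discrete cubes all of whose coordinates are literals. -/
def IsLiteralMap {ι κ : Type*} (φ : (ι → Bool) → (κ → Bool)) : Prop :=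
  ∀ j, IsLiteral fun u => φ u j

section Literal

variable {ι κ μ : Type*}

theorem IsLiteral.const (b : Bool) : IsLiteral fun _ : ι → Bool => b := Or.inl ⟨b, fun _ => rfl⟩

theorem IsLiteral.var (i : ι) : IsLiteral fun u : ι → Bool => u i := Or.inr (Or.inl ⟨i, fun _ => rfl⟩)

theorem IsLiteral.not {g : (ι → Bool) → Bool} (hg : IsLiteral g) : IsLiteral fun u => !g u := by
  rcases hg with ⟨b, hb⟩ | ⟨i, hi⟩ | ⟨i, hi⟩
  · exact Or.inl ⟨!b, fun u => by simp only [hb]⟩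
  · exact Or.inr (Or.inr ⟨i, fun u => by simp only [hi]⟩)
  · exact Or.inr (Or.inl ⟨i, fun u => by simp only [hi, Bool.not_not]⟩)

theorem IsLiteral.and_const {g : (ι → Bool) → Bool} (hg : IsLiteral g) (b : Bool) :
    IsLiteral fun u => g u && b := by
  cases b
  · simpa using IsLiteral.const false
  · simpa using hg

theorem IsLiteral.xor_const {g : (ι → Bool) → Bool} (hg : IsLiteral g) (b : Bool) :
    IsLiteral fun u => xor (g u) b := by
  cases b
  · simpa using hg
  · simpa using hg.not

theorem IsLiteral.comp {g : (κ → Bool) → Bool} (hg : IsLiteral g) {φ : (ι → Bool) → (κ → Bool)}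
    (hφ : IsLiteralMap φ) : IsLiteral fun u => g (φ u) := by
  rcases hg with ⟨b, hb⟩ | ⟨i, hi⟩ | ⟨i, hi⟩
  · exact Or.inl ⟨b, fun u => hb _⟩
  · simpa only [hi] using hφ i
  · simpa only [hi] using (hφ i).not

theorem IsLiteralMap.comp {ψ : (κ → Bool) → (μ → Bool)} (hψ : IsLiteralMap ψ)
    {φ : (ι → Bool) → (κ → Bool)} (hφ : IsLiteralMap φ) : IsLiteralMap fun u => ψ (φ u) :=
  fun j => (hψ j).comp hφ

theorem IsLiteralMap.id : IsLiteralMap fun u : ι → Bool => u := fun j => IsLiteral.var j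

theorem IsLiteralMap.inf_const (v : ι → Bool) : IsLiteralMap fun u : ι → Bool => u ⊓ v :=
  fun j => (IsLiteral.var j).and_const (v j)

theorem IsLiteralMap.xor_const (v : ι → Bool) :
    IsLiteralMap fun (u : ι → Bool) (j : ι) => xor (u j) (v j) :=
  fun j => (IsLiteral.var j).xor_const (v j)

theorem IsLiteralMap.reindex (e : κ → ι) : IsLiteralMap fun (u : ι → Bool) (j : κ) => u (e j) :=
  fun j => IsLiteral.var (e j)

theorem IsLiteralMap.isMorphism {m n : ℕ} {φ : DCube m → DCube n} (hφ : IsLiteralMap φ) :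
    DCube.IsMorphism φ := by
  have key : ∀ j, ∃ (L : (Fin m → ℤ) →+ ℤ) (t : ℤ), ∀ v,
      DCube.toInt (φ v) j = L (DCube.toInt v) + t := by
    intro j
    rcases hφ j with ⟨b, hb⟩ | ⟨i, hi⟩ | ⟨i, hi⟩
    · exact ⟨0, if b = true then 1 else 0, fun v => by simp [DCube.toInt, hb]⟩
    · exact ⟨Pi.evalAddMonoidHom _ i, 0, fun v => by simp [DCube.toInt, hi]⟩
    · refine ⟨-Pi.evalAddMonoidHom _ i, 1, fun v => ?_⟩
      cases h : v i <;> simp [DCube.toInt, hi, h]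
  choose L t h using key
  exact ⟨AddMonoidHom.mk' (fun z j => L j z) (fun a b => by ext j; simp), t,
    fun v => by ext j; simpa using h j v⟩

end Literal

/-- `q` is a cube with coordinates indexed by `ι`. -/
def IsCubeOn {X ι : Type*} (C : CubeFamily X) (q : (ι → Bool) → X) : Prop :=
  ∀ (n : ℕ) (φ : DCube n → (ι → Bool)), IsLiteralMap φ → (fun u => q (φ u)) ∈ C n

/-! ### Completion, extension and gluing of cubes -/

section Cubes

variable {X ι κ : Type*} {C : CubeFamily X}

theorem IsCubeOn.comp {q : (ι → Bool) → X} (hq : IsCubeOn C q) {ψ : (κ → Bool) → (ι → Bool)}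
    (hψ : IsLiteralMap ψ) : IsCubeOn C fun u => q (ψ u) :=
  fun n _ hφ => hq n _ (hψ.comp hφ)

theorem IsCubeOn.mem {n : ℕ} {q : DCube n → X} (hq : IsCubeOn C q) : q ∈ C n :=
  hq n _ IsLiteralMap.id

theorem IsNilspace.isCubeOn (hC : IsNilspace C) {n : ℕ} {q : DCube n → X} (hq : q ∈ C n) :
    IsCubeOn C q :=
  fun m φ hφ => hC.composition m n φ hφ.isMorphism q hq

theorem IsNilspace.isCubeOn_pair (hC : IsNilspace C) (x y : X) (i : ι) :
    IsCubeOn C fun u : ι → Bool => if u i = true then y else x := by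
  have h : (fun u : DCube 1 => if u 0 = true then y else x) ∈ C 1 := by
    rw [hC.ergodicity]; trivial
  exact (hC.isCubeOn h).comp (IsLiteralMap.reindex fun _ => i)

theorem IsNilspace.isCubeOn_const (hC : IsNilspace C) (x : X) :
    IsCubeOn C fun _ : ι → Bool => x := by
  have h : (fun _ : DCube 1 => x) ∈ C 1 := by
    rw [hC.ergodicity]; trivial
  exact (hC.isCubeOn h).comp (ψ := fun _ _ => false) fun _ => IsLiteral.const _

/-- Corner completion below a vertex `v`. -/
theorem IsNilspace.exists_completion_below [DecidableEq ι] [Fintype ι] (hC : IsNilspace C)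
    (f : (ι → Bool) → X) (v : ι → Bool)
    (h : ∀ j, v j = true → IsCubeOn C fun u => f (u ⊓ Function.update v j false)) :
    ∃ x, IsCubeOn C fun u => Function.update f v x (u ⊓ v) := by
  rcases hn : Fintype.card {i // v i = true} with _ | n
  -- Corner completion starts in dimension one; below `⊥` there is a single vertex, and constant
  -- maps are cubes.
  · have hv : v = ⊥ := by
      rw [Fintype.card_eq_zero_iff] at hn
      funext i
      by_contra hi
      exact hn.false ⟨i, by simpa using hi⟩
    refine ⟨f v, ?_⟩
    subst hv
    simpa using hC.isCubeOn_const (f ⊥)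
  have e : Fin (n + 1) ≃ {i // v i = true} := (Fintype.equivFinOfCardEq hn).symm
  let E : DCube (n + 1) → (ι → Bool) := fun a i => if h : v i = true then a (e.symm ⟨i, h⟩) else false
  have hE : IsLiteralMap E := by
    intro i
    by_cases hi : v i = true
    · simpa [E, hi] using IsLiteral.var _
    · simpa [E, hi] using IsLiteral.const _
  have hEe : ∀ a l, E a (e l) = a l := fun a l => by simp [E, (e l).2]
  have hEv : ∀ a, E a = v → a = DCube.one _ := by
    intro a ha
    funext l
    rw [← hEe a l, ha]
    exact (e l).2
  have hE1 : E (DCube.one _) = v := by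
    funext i
    by_cases hi : v i = true <;> simp [E, hi, DCube.one]
  have hEr : ∀ u : ι → Bool, E (fun l => u (e l)) = u ⊓ v := by
    intro u
    funext i
    by_cases hi : v i = true <;> simp [E, hi]
  obtain ⟨c, hc, hcf⟩ := hC.corner_completion n (fun a => f (E a)) (by
    intro j
    have hins : IsLiteralMap fun u : DCube n =>
        (j.insertNth (α := fun _ => Bool) false u : DCube (n + 1)) := by
      intro l
      rcases Fin.eq_self_or_eq_succAbove j l with rfl | ⟨l', rfl⟩
      · simpa using IsLiteral.const _
      · simpa using IsLiteral.var _
    have h1 := ((h (e j) (e j).2).comp (hE.comp hins)).mem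
    convert h1 using 3 with u
    funext i
    by_cases hi : i = e j
    · subst hi
      simp [hEe]
    · by_cases hv : v i = true <;> simp [E, hi, hv])
  refine ⟨c (DCube.one _), ?_⟩
  have h2 := (hC.isCubeOn hc).comp (IsLiteralMap.reindex fun l => (e l : ι))
  convert h2 using 2 with u
  by_cases hu : (fun l => u (e l)) = DCube.one (n + 1)
  · rw [← hEr, hu, hE1, Function.update_self]
  · rw [hcf _ hu, ← hEr, Function.update_of_ne]
    exact fun h => hu (hEv _ h)

/-- Maps defined on a lower set of vertices, and which are cubes on all the faces contained in it,
extend to cubes. -/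
theorem IsNilspace.exists_extension [Fintype ι] (hC : IsNilspace C) (S : Set (ι → Bool))
    (hS : IsLowerSet S) (f : (ι → Bool) → X)
    (hf : ∀ v ∈ S, IsCubeOn C fun u => f (u ⊓ v)) :
    ∃ g, IsCubeOn C g ∧ ∀ v ∈ S, g v = f v := by
  classical
  induction hm : Sᶜ.ncard using Nat.strong_induction_on generalizing S f with
  | _ m ih =>
    rcases (Sᶜ).eq_empty_or_nonempty with h | h
    · rw [Set.compl_empty_iff] at h
      subst h
      refine ⟨f, ?_, fun _ _ => rfl⟩
      simpa using hf ⊤ trivial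
    -- All vertices strictly below a minimal missing vertex lie in `S`, so `f` is already a corner
    -- there.
    · obtain ⟨v, hv⟩ := (Set.toFinite Sᶜ).exists_minimal h
      have hlt : ∀ u, u < v → u ∈ S := fun u hu => by
        by_contra hu'
        exact hu.not_ge (hv.2 hu' hu.le)
      obtain ⟨x, hx⟩ := hC.exists_completion_below f v fun j hj => hf _ (hlt _ (by
        rw [Pi.lt_def]
        refine ⟨fun i => ?_, j, by simp [hj]⟩
        by_cases hi : i = j
        · subst hi; simp
        · simp [hi]))
      obtain ⟨g, hg, hgf⟩ := ih (insert v S)ᶜ.ncard (by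
          rw [← hm]
          refine Set.ncard_lt_ncard ?_ (Set.toFinite _)
          refine ⟨Set.compl_subset_compl.2 (Set.subset_insert _ _), fun hh => ?_⟩
          exact hh hv.1 (Set.mem_insert _ _)) (insert v S) (by
          intro a b hba ha
          rcases ha with rfl | ha
          · rcases hba.eq_or_lt with rfl | hlt'
            · exact Set.mem_insert _ _
            · exact Set.mem_insert_of_mem _ (hlt _ hlt')
          · exact Set.mem_insert_of_mem _ (hS hba ha)) (Function.update f v x) (by
          intro w hw
          rcases hw with rfl | hw
          · exact hx
          · convert hf w hw using 2 with u
            rw [Function.update_of_ne]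
            rintro rfl
            exact hv.1 (hS inf_le_right hw)) rfl
      refine ⟨g, hg, fun w hw => ?_⟩
      rw [hgf w (Set.mem_insert_of_mem _ hw), Function.update_of_ne]
      rintro rfl
      exact hv.1 hw

theorem IsStepNilspace.eq_of_eq_off_one {k : ℕ} (hC : IsStepNilspace C k) {q q' : DCube (k + 1) → X}
    (hq : IsCubeOn C q) (hq' : IsCubeOn C q') (h : ∀ v, v ≠ DCube.one _ → q v = q' v) : q = q' := by
  have hcorner : IsCubeCorner C k q := fun j => hq _ _ (by
    intro l
    rcases Fin.eq_self_or_eq_succAbove j l with rfl | ⟨l', rfl⟩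
    · simpa using IsLiteral.const _
    · simpa using IsLiteral.var _)
  exact (hC.unique_completion q hcorner).unique ⟨hq.mem, fun _ _ => rfl⟩
    ⟨hq'.mem, fun v hv => (h v hv).symm⟩

theorem IsStepNilspace.eq_of_eq_off {k : ℕ} (hC : IsStepNilspace C k) {q q' : DCube (k + 1) → X}
    (hq : IsCubeOn C q) (hq' : IsCubeOn C q') (w : DCube (k + 1)) (h : ∀ v, v ≠ w → q v = q' v) :
    q = q' := by
  have hx := IsLiteralMap.xor_const (fun j => !w j)
  have h1 := hC.eq_of_eq_off_one (hq.comp hx) (hq'.comp hx) (fun v hv => h _ (by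
    intro hvw
    refine hv (funext fun j => ?_)
    have := congrFun hvw j
    cases hj : v j <;> simp_all [DCube.one]))
  funext v
  have h2 := congrFun h1 (fun j => xor (v j) (!w j))
  simpa using h2

/-- On a `k`-step nilspace, cubes are detected by `(k+1)`-dimensional faces. -/
theorem IsStepNilspace.isCubeOn_of_forall_comp {k : ℕ} [Fintype ι] (hC : IsStepNilspace C k)
    (f : (ι → Bool) → X)
    (hf : ∀ ψ : DCube (k + 1) → (ι → Bool), IsLiteralMap ψ → IsCubeOn C fun u => f (ψ u)) :
    IsCubeOn C f := by
  classical
  have key : ∀ v : ι → Bool, IsCubeOn C fun u => f (u ⊓ v) := by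
    intro v
    induction v using WellFoundedLT.induction with
    | _ v ih =>
      rcases le_total (Fintype.card {i // v i = true}) (Fintype.card (Fin (k + 1))) with h | h
      · obtain ⟨g⟩ := Function.Embedding.nonempty_of_card_le h
        have h1 := hf (fun a i => if h : v i = true then a (g ⟨i, h⟩) else false) (fun i => by
          by_cases hi : v i = true
          · simpa [hi] using IsLiteral.var _
          · simpa [hi] using IsLiteral.const _)
        have h2 := h1.comp (ψ := fun (u : ι → Bool) l =>
          if h : ∃ i, g i = l then u h.choose else false) (fun l => by
          by_cases hl : ∃ i, g i = l
          · simpa only [dif_pos hl] using IsLiteral.var _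
          · simpa only [dif_neg hl] using IsLiteral.const _)
        convert h2 using 3 with u
        funext i
        by_cases hi : v i = true
        · have hex : ∃ i', g i' = g ⟨i, hi⟩ := ⟨_, rfl⟩
          have := g.injective hex.choose_spec
          simp only [Pi.inf_apply, hi, dif_pos, dif_pos hex]
          rw [this]
          simp
        · simp [hi]
      -- In high dimension, complete the corner below `v` and show that the new value is forced to
      -- be `f v`.
      · obtain ⟨x, hx⟩ := hC.exists_completion_below f v fun j hj => ih _ (by
          rw [Pi.lt_def]
          refine ⟨fun i => ?_, j, by simp [hj]⟩
          by_cases hi : i = j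
          · subst hi; simp
          · simp [hi])
        suffices hxv : x = f v by simpa [hxv] using hx
        obtain ⟨g⟩ := Function.Embedding.nonempty_of_card_le h
        -- A `(k+1)`-face with top vertex `v`: on it `f` and the completion are cubes agreeing off
        -- the top, hence equal.
        let ψ : DCube (k + 1) → (ι → Bool) := fun a i =>
          if h : ∃ l, (g l : ι) = i then a h.choose else v i
        have hψ : IsLiteralMap ψ := fun i => by
          by_cases hi : ∃ l, (g l : ι) = i
          · simpa only [ψ, dif_pos hi] using IsLiteral.var _
          · simpa only [ψ, dif_neg hi] using IsLiteral.const _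
        have hψv : ∀ a, ψ a ⊓ v = ψ a := by
          intro a
          funext i
          by_cases hi : ∃ l, (g l : ι) = i
          · obtain ⟨l, rfl⟩ := hi
            simp [(g l).2]
          · simp only [ψ, Pi.inf_apply, dif_neg hi, inf_idem]
        have hψ1 : ψ (DCube.one _) = v := by
          funext i
          by_cases hi : ∃ l, (g l : ι) = i
          · obtain ⟨l, rfl⟩ := hi
            simp [ψ, (g l).2, DCube.one]
          · simp only [ψ, dif_neg hi]
        have hψg : ∀ a l, ψ a (g l) = a l := by
          intro a l
          have hex : ∃ l', (g l' : ι) = g l := ⟨l, rfl⟩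
          have := g.injective (Subtype.ext hex.choose_spec)
          simp only [ψ, dif_pos hex]
          rw [this]
        have heq := hC.eq_of_eq_off_one (hf ψ hψ) (hx.comp hψ) (fun a ha => by
          rw [hψv, Function.update_of_ne]
          intro h
          refine ha (funext fun l => ?_)
          rw [← hψg a l, h]
          exact (g l).2)
        have := congrFun heq (DCube.one _)
        simpa [hψ1] using this.symm
  simpa using key ⊤

/-- If the cubes `p₀`, `p₁` differ only on the face where the coordinates in `J` vanish, and `q` is
a cube with the same values as `p₀` on this face, then these values can be replaced by those of
`p₁`. -/
theorem IsNilspace.isCubeOn_replace [Fintype κ] (hC : IsNilspace C) (J : Set κ)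
    {p₀ p₁ q q' : (κ → Bool) → X} (h₀ : IsCubeOn C p₀) (h₁ : IsCubeOn C p₁) (hq : IsCubeOn C q)
    (h₀q : ∀ v, (∀ j ∈ J, v j = false) → p₀ v = q v)
    (h₀₁ : ∀ v, (¬ ∀ j ∈ J, v j = false) → p₀ v = p₁ v)
    (hq'p : ∀ v, (∀ j ∈ J, v j = false) → q' v = p₁ v)
    (hq'q : ∀ v, (¬ ∀ j ∈ J, v j = false) → q' v = q v) : IsCubeOn C q' := by
  classical
  let mix : (κ ⊕ κ → Bool) → (κ → Bool) := fun z j => if j ∈ J then z (Sum.inr j) else z (Sum.inl j)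
  have hmix : IsLiteralMap mix := fun j => by
    by_cases hj : j ∈ J
    · simpa [mix, hj] using IsLiteral.var _
    · simpa [mix, hj] using IsLiteral.var _
  -- Double the coordinates: `q` runs along the left copy and `p₀` along the right copy of `J`; they
  -- agree on the common face by `h₀q`.
  obtain ⟨K, hK, hKf⟩ := hC.exists_extension
    {z : κ ⊕ κ → Bool | (∀ j ∈ J, z (Sum.inl j) = false) ∨ ∀ j ∈ J, z (Sum.inr j) = false}
    (by
      rintro a b hba (h | h)
      · exact Or.inl fun j hj => le_bot_iff.1 ((hba (Sum.inl j)).trans (h j hj).le)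
      · exact Or.inr fun j hj => le_bot_iff.1 ((hba (Sum.inr j)).trans (h j hj).le))
    (fun z => if ∀ j ∈ J, z (Sum.inr j) = false then q (fun j => z (Sum.inl j)) else p₀ (mix z))
    (by
      rintro z (h | h)
      · have := h₀.comp (hmix.comp (IsLiteralMap.inf_const z))
        convert this using 2 with u
        split_ifs with hh
        · rw [← h₀q]
          · congr 1
            funext j
            by_cases hj : j ∈ J
            · have := hh j hj
              simp only [Pi.inf_apply] at this
              simp [mix, hj, h j hj, this]
            · simp [mix, hj]
          · intro j hj
            simp [h j hj]
        · rfl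
      · have := hq.comp ((IsLiteralMap.reindex Sum.inl).comp (IsLiteralMap.inf_const z))
        convert this using 2 with u
        rw [if_pos]
        intro j hj
        simp [h j hj])
  have hKq : ∀ z : κ ⊕ κ → Bool, (∀ j ∈ J, z (Sum.inr j) = false) →
      K z = q (fun j => z (Sum.inl j)) := by
    intro z hz
    rw [hKf z (Or.inr hz), if_pos hz]
  have hKp : ∀ z : κ ⊕ κ → Bool, (∀ j ∈ J, z (Sum.inl j) = false) → K z = p₀ (mix z) := by
    intro z hz
    rw [hKf z (Or.inl hz)]
    split_ifs with hh
    · rw [← h₀q _ hz]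
      congr 1
      funext j
      by_cases hj : j ∈ J <;> simp [mix, hj, hz, hh]
    · rfl
  -- For `j ∈ J` the pairs `00`, `10`, `01` index a subdivided side. `τ` sends `00` to `01`, `10` to
  -- itself and `01` to `00`, so the `p₀` part is traversed backwards and its far end is where `p₁`
  -- may replace it.
  let τ : (κ ⊕ κ → Bool) → (κ ⊕ κ → Bool) := fun z => Sum.elim (fun j => z (Sum.inl j))
    (fun j => if j ∈ J then !z (Sum.inl j) && !z (Sum.inr j) else false)
  let low : (κ ⊕ κ → Bool) → (κ → Bool) := fun z j => if j ∈ J then false else z (Sum.inl j)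
  obtain ⟨K', hK', hKf'⟩ := hC.exists_extension
    {z : κ ⊕ κ → Bool | ∀ j ∈ J, z (Sum.inl j) = false ∨ z (Sum.inr j) = false}
    (by
      rintro a b hba h j hj
      rcases h j hj with h | h
      · exact Or.inl (le_bot_iff.1 ((hba (Sum.inl j)).trans h.le))
      · exact Or.inr (le_bot_iff.1 ((hba (Sum.inr j)).trans h.le)))
    (fun z => if ∀ j ∈ J, z (Sum.inr j) = true then p₁ (low z) else K (τ z))
    (by
      intro z hz
      by_cases hz1 : ∀ j ∈ J, z (Sum.inr j) = true
      · have hz0 : ∀ j ∈ J, z (Sum.inl j) = false := fun j hj => by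
          simpa [hz1 j hj] using hz j hj
        have := h₁.comp (ψ := fun (u : κ ⊕ κ → Bool) j =>
          if j ∈ J then !u (Sum.inr j) else (u (Sum.inl j) && z (Sum.inl j))) (fun j => by
            by_cases hj : j ∈ J
            · simpa only [if_pos hj] using (IsLiteral.var _).not
            · simpa only [if_neg hj] using (IsLiteral.var _).and_const _)
        convert this using 2 with u
        split_ifs with hh
        · congr 1
          funext j
          by_cases hj : j ∈ J
          · have := hh j hj
            simp [hz1 j hj] at this
            simp [low, hj, this]
          · simp [low, hj]
        · rw [hKp _ (fun j hj => by simp [τ, hz0 j hj]), ← h₀₁]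
          · congr 1
            funext j
            by_cases hj : j ∈ J
            · simp [mix, τ, hj, hz0 j hj, hz1 j hj]
            · simp [mix, τ, hj]
          · intro h
            refine hh fun j hj => ?_
            have := h j hj
            simp [hj] at this
            simp [this, hz1 j hj]
      · have := hK.comp (ψ := fun u => τ (u ⊓ z)) (by
          rintro (j | j)
          · exact (IsLiteral.var _).and_const _
          · by_cases hj : j ∈ J
            · rcases hz j hj with h | h
              · simpa [τ, hj, h, Bool.not_and] using ((IsLiteral.var _).and_const _).not
              · simpa [τ, hj, h, Bool.not_and] using ((IsLiteral.var _).and_const _).not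
            · simpa [τ, hj] using IsLiteral.const _)
        convert this using 2 with u
        rw [if_neg]
        intro h
        refine hz1 fun j hj => ?_
        have := h j hj
        simp at this
        exact this.2)
  -- The outer vertices of the subdivided cube, where only pairs `10` and `01` occur over `J`, carry
  -- exactly `q'`.
  have := hK'.comp (ψ := fun (v : κ → Bool) => Sum.elim v (fun j => !v j)) (by
    rintro (j | j)
    · exact IsLiteral.var _
    · exact (IsLiteral.var _).not)
  convert this using 2 with v
  rw [hKf' _ (fun j _ => by cases h : v j <;> simp [h])]
  by_cases hv : ∀ j ∈ J, v j = false
  · rw [hq'p v hv, if_pos]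
    · congr 1
      funext j
      by_cases hj : j ∈ J <;> simp [low, hj, hv]
    · intro j hj
      simp [hv j hj]
  · rw [hq'q v hv, if_neg, hKq]
    · rfl
    · intro j hj
      simp [τ]
    · intro h
      exact hv fun j hj => by simpa using h j hj

end Cubes

/-! ### Parallel displacements in the fibres of `π_s` -/

section Parallel

variable {X ι : Type*} {C : CubeFamily X} {s : ℕ}

/-- Corner completion at an arbitrary vertex `w`. -/
theorem IsNilspace.exists_completion_at [DecidableEq ι] [Fintype ι] (hC : IsNilspace C)
    (f : (ι → Bool) → X) (w : ι → Bool)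
    (h : ∀ j, IsCubeOn C fun u => f (Function.update u j (!w j))) :
    ∃ x, IsCubeOn C (Function.update f w x) := by
  have hx := IsLiteralMap.xor_const (fun j => !w j)
  obtain ⟨x, hx'⟩ := hC.exists_completion_below (fun u => f fun j => xor (u j) (!w j)) ⊤ (by
    intro j _
    convert (h j).comp hx using 3 with u
    funext i
    by_cases hi : i = j
    · subst hi; simp
    · simp [hi])
  refine ⟨x, ?_⟩
  convert hx'.comp hx using 1
  funext u
  by_cases hu : u = w
  · subst hu
    have : (fun j => xor (u j) (!u j)) = (⊤ : ι → Bool) := by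
      funext j; cases u j <;> rfl
    simp only [Function.update_self, this, inf_top_eq]
  · rw [Function.update_of_ne hu, inf_top_eq, Function.update_of_ne]
    · simp
    · intro h
      refine hu (funext fun j => ?_)
      have := congrFun h j
      cases hj : u j <;> simp_all

/-- The map equal to `x`, `y` on the two facets transversal to the coordinate `0`, except at the
endpoints of one edge between these facets, where the values are `x'` and `y'`. -/
def edgeMap (s : ℕ) (x x' y y' : X) : DCube (s + 2) → X := fun v =>
  if ∀ j, j ≠ 0 → v j = false then (if v 0 = true then y' else x') else if v 0 = true then y else x

theorem edgeMap_of_forall {v : DCube (s + 2)} (h : ∀ j, j ≠ 0 → v j = false) (x x' y y' : X) :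
    edgeMap s x x' y y' v = if v 0 = true then y' else x' := if_pos h

theorem edgeMap_of_not_forall {v : DCube (s + 2)} (h : ¬ ∀ j, j ≠ 0 → v j = false)
    (x x' y y' : X) : edgeMap s x x' y y' v = if v 0 = true then y else x := if_neg h

/-- The points `x, x'` and `y, y'` lie in fibres of `π_s` and have the same difference. -/
def Parallel (C : CubeFamily X) (s : ℕ) (x x' y y' : X) : Prop :=
  IsCubeOn C (edgeMap s x x' y y')

theorem Parallel.refl (hC : IsNilspace C) (x y : X) : Parallel C s x x y y := by
  unfold Parallel
  convert hC.isCubeOn_pair x y (0 : Fin (s + 2)) using 1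
  funext v
  simp [edgeMap]

theorem Parallel.swap {x x' y y' : X} (h : Parallel C s x x' y y') : Parallel C s y y' x x' := by
  unfold Parallel
  convert IsCubeOn.comp h (IsLiteralMap.xor_const fun j => decide (j = 0)) using 1
  funext v
  have : (∀ j, j ≠ 0 → xor (v j) (decide (j = 0)) = false) ↔ ∀ j, j ≠ 0 → v j = false :=
    forall_congr' fun j => imp_congr_right fun hj => by simp [hj]
  simp only [edgeMap, this]
  cases h : v 0 <;> simp

/-- Replace the edge `x, y` by `x', y'` in the cube that is `x'` and `y'` on its two facets. -/
theorem Parallel.reverse (hC : IsNilspace C) {x x' y y' : X} (h : Parallel C s x x' y y') :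
    Parallel C s x' x y' y := by
  refine hC.isCubeOn_replace {j : Fin (s + 2) | j ≠ 0} h (hC.isCubeOn_pair x y 0)
    (hC.isCubeOn_pair x' y' 0) ?_ ?_ ?_ ?_ <;> intro v hv <;> simp_all [edgeMap]

theorem Parallel.charRel_right (hC : IsNilspace C) {x x' y y' : X} (h : Parallel C s x x' y y') :
    charRel C s y y' := by
  have hl : IsLiteralMap fun (u : DCube (s + 1)) => (Fin.cons true u : DCube (s + 2)) := by
    intro j
    refine Fin.cases ?_ (fun j => ?_) j
    · simpa using IsLiteral.const _
    · simpa using IsLiteral.var _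
  refine ⟨_, (hC.isCubeOn_const y).mem, _, (IsCubeOn.comp h hl).mem, rfl, ?_, fun v hv => ?_⟩
  · simp only [edgeMap]
    rw [if_pos]
    · simp
    · intro j hj
      obtain ⟨l, rfl⟩ := Fin.exists_succ_eq.2 hj
      simp [DCube.zero]
  · simp only [edgeMap]
    rw [if_neg]
    · simp
    · intro h
      refine hv (funext fun j => ?_)
      simpa [DCube.zero] using h j.succ (Fin.succ_ne_zero j)

theorem Parallel.charRel_left (hC : IsNilspace C) {x x' y y' : X} (h : Parallel C s x x' y y') :
    charRel C s x x' :=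
  h.swap.charRel_right hC

/-- Gluing with a constant cube normalises the witnesses of `charRel`: they may be taken constant
`x` away from `0`. Then repeat the result along one more coordinate. -/
theorem Parallel.of_charRel (hC : IsNilspace C) {x x' : X} (h : charRel C s x x') :
    Parallel C s x x' x x' := by
  obtain ⟨q₀, h₀, q₁, h₁, rfl, rfl, h⟩ := h
  have hz : ∀ v : DCube (s + 1), (∀ j ∈ Set.univ, v j = false) ↔ v = DCube.zero _ := fun v =>
    ⟨fun h => funext fun j => h j trivial, fun h j _ => by rw [h]; rfl⟩
  have h1 := hC.isCubeOn_replace Set.univ (hC.isCubeOn h₀) (hC.isCubeOn h₁)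
    (hC.isCubeOn_const (q₀ (DCube.zero _)))
    (q' := fun v => if v = DCube.zero _ then q₁ (DCube.zero _) else q₀ (DCube.zero _))
    (fun v hv => by rw [(hz v).1 hv])
    (fun v hv => h v (by rwa [hz] at hv))
    (fun v hv => by rw [(hz v).1 hv, if_pos rfl])
    (fun v hv => by rw [hz] at hv; rw [if_neg hv])
  unfold Parallel
  convert h1.comp (IsLiteralMap.reindex Fin.succ) using 1
  funext v
  have : (∀ j, j ≠ 0 → v j = false) ↔ (fun j : Fin (s + 1) => v j.succ) = DCube.zero _ := by
    constructor
    · exact fun h => funext fun j => h _ (Fin.succ_ne_zero j)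
    · intro h j hj
      obtain ⟨l, rfl⟩ := Fin.exists_succ_eq.2 hj
      exact congrFun h l
  simp [edgeMap, this]

/-- All of `edgeMap` is prescribed except the value at the endpoint `(1, 0, …, 0)`, and the
prescribed values form a corner there. -/
theorem Parallel.exists (hC : IsNilspace C) {x x' : X} (h : charRel C s x x') (y : X) :
    ∃ y', Parallel C s x x' y y' := by
  obtain ⟨y', hy'⟩ := hC.exists_completion_at (edgeMap s x x' y y)
    (fun j => decide (j = 0)) (by
    intro j
    by_cases hj : j = 0
    · subst hj
      have hl : IsLiteralMap fun u : DCube (s + 2) =>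
          Function.update u 0 (!decide ((0 : Fin (s + 2)) = 0)) := by
        intro i
        by_cases hi : i = 0
        · subst hi; simpa using IsLiteral.const _
        · simpa [hi] using IsLiteral.var _
      convert IsCubeOn.comp (Parallel.of_charRel hC h) hl using 2 with u
      simp [edgeMap]
    · convert hC.isCubeOn_pair x y (0 : Fin (s + 2)) using 2 with u
      simp only [edgeMap]
      rw [if_neg, Function.update_of_ne (Ne.symm hj)]
      intro h
      simpa [hj] using h j hj)
  refine ⟨y', ?_⟩
  unfold Parallel
  convert hy' using 1
  funext u
  by_cases hu : u = fun j => decide (j = 0)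
  · subst hu
    simp [edgeMap]
  · rw [Function.update_of_ne hu]
    simp only [edgeMap]
    split_ifs with h1 h2
    · refine absurd (funext fun j => ?_) hu
      by_cases hj : j = 0
      · simp [hj, h2]
      · simp [hj, h1 j hj]
    all_goals rfl

/-- The dimension `s + 2` of `edgeMap` is the one in which completion is unique on an `(s+1)`-step
nilspace. -/
theorem Parallel.unique (hC : IsStepNilspace C (s + 1)) {x x' y y₁ y₂ : X}
    (h₁ : Parallel C s x x' y y₁) (h₂ : Parallel C s x x' y y₂) : y₁ = y₂ := by
  have h := hC.eq_of_eq_off h₁ h₂ (fun j => decide (j = 0)) (by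
    intro u hu
    simp only [edgeMap]
    split_ifs with h1 h2
    · refine absurd (funext fun j => ?_) hu
      by_cases hj : j = 0
      · simp [hj, h2]
      · simp [hj, h1 j hj]
    all_goals rfl)
  have h' := congrFun h fun j => decide (j = 0)
  simpa [edgeMap] using h'

theorem Parallel.trans (hC : IsNilspace C) {x x' y y' z z' : X} (h₁ : Parallel C s x x' y y')
    (h₂ : Parallel C s x x' z z') : Parallel C s y y' z z' := by
  obtain ⟨t, ht⟩ := hC.exists_completion_at
    (fun u : Bool → Bool => if u true = true then y else if u false = true then z else x)
    (fun _ => true) (by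
      rintro (_ | _)
      · simpa using hC.isCubeOn_pair x y true
      · simpa using hC.isCubeOn_pair x z false)
  have ht' : ∀ u : Bool → Bool, Function.update (fun u : Bool → Bool =>
      if u true = true then y else if u false = true then z else x) (fun _ => true) t u =
      if u true = true then (if u false = true then t else y) else
        if u false = true then z else x := by
    intro u
    have : u = (fun _ => true) ↔ u true = true ∧ u false = true :=
      ⟨fun h => by simp [h], fun h => funext fun b => by cases b; exacts [h.2, h.1]⟩
    simp only [Function.update_apply, this]
    split_ifs <;> simp_all
  have hr : IsCubeOn C fun u : Bool → Bool => if u true = true then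
      (if u false = true then t else y) else if u false = true then z else x := by
    convert ht using 1
    exact funext fun u => (ht' u).symm
  -- The square `x, y, z, t` is repeated along `s + 1` further coordinates, with primed values where
  -- these vanish. The fourth primed value is found by completion; the one written here is a dummy.
  let f : (Fin (s + 1) ⊕ Bool → Bool) → X := fun u =>
    if ∀ j, u (Sum.inl j) = false then
      if u (Sum.inr true) = true then y' else if u (Sum.inr false) = true then z' else x'
    else if u (Sum.inr true) = true then (if u (Sum.inr false) = true then t else y) else
      if u (Sum.inr false) = true then z else x
  have hface : ∀ {a a' : X} (b : Bool), Parallel C s x x' a a' →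
      IsCubeOn C fun u : Fin (s + 1) ⊕ Bool → Bool => if ∀ j, u (Sum.inl j) = false then
        (if u (Sum.inr b) = true then a' else x') else if u (Sum.inr b) = true then a else x := by
    intro a a' b h
    have hl : IsLiteralMap fun (u : Fin (s + 1) ⊕ Bool → Bool) =>
        (Fin.cons (u (Sum.inr b)) (fun j => u (Sum.inl j)) : DCube (s + 2)) := by
      intro j
      refine Fin.cases ?_ (fun j => ?_) j
      · simpa using IsLiteral.var _
      · simpa using IsLiteral.var _
    convert IsCubeOn.comp h hl using 2 with u
    have : (∀ j : Fin (s + 2), j ≠ 0 →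
        (Fin.cons (u (Sum.inr b)) (fun j => u (Sum.inl j)) : DCube (s + 2)) j = false) ↔
        ∀ j, u (Sum.inl j) = false := by
      rw [Fin.forall_fin_succ]
      simp
    simp [edgeMap, this]
  obtain ⟨w, hw⟩ := hC.exists_completion_at f (Sum.elim (fun _ => false) fun _ => true) (by
    rintro (j | (_ | _))
    · convert hr.comp (IsLiteralMap.reindex (Sum.inr : Bool → Fin (s + 1) ⊕ Bool)) using 2 with u
      simp only [f]
      rw [if_neg]
      · simp
      · intro h
        simpa using h j
    · simpa [f] using hface true h₁
    · simpa [f] using hface false h₂)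
  -- The antidiagonal of the square joins `y` to `z` and avoids the completed vertex.
  have hφ : IsLiteralMap fun (u : DCube (s + 2)) =>
      (Sum.elim (fun j => u (Fin.succ j)) (fun b => if b = true then !u 0 else u 0) :
        Fin (s + 1) ⊕ Bool → Bool) := by
    rintro (j | (_ | _))
    · exact IsLiteral.var _
    · exact IsLiteral.var _
    · exact (IsLiteral.var _).not
  unfold Parallel
  convert hw.comp hφ using 1
  funext u
  rw [Function.update_of_ne]
  · have : (∀ j : Fin (s + 2), j ≠ 0 → u j = false) ↔ ∀ j : Fin (s + 1), u j.succ = false := by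
      rw [Fin.forall_fin_succ]
      simp
    simp only [edgeMap, this, f, Sum.elim_inl, Sum.elim_inr]
    cases u 0 <;> simp
  · intro h
    have h1 := congrFun h (Sum.inr true)
    have h2 := congrFun h (Sum.inr false)
    simp at h1 h2
    simp_all

/-- Moving the endpoints of an edge of a cube by parallel displacements yields a cube. -/
theorem Parallel.update_edge (hC : IsNilspace C) {q : DCube (s + 2) → X} (hq : IsCubeOn C q)
    (v : DCube (s + 2)) (j : Fin (s + 2)) {y' z' : X} (hv : v j = false)
    (h : Parallel C s (q v) y' (q (Function.update v j true)) z') :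
    IsCubeOn C (Function.update (Function.update q v y') (Function.update v j true) z') := by
  have hvw : v ≠ Function.update v j true := fun h => by
    have := congrFun h j
    simp [hv] at this
  have hx := IsLiteralMap.xor_const v
  have h0 : ∀ u : DCube (s + 2), (∀ l ∈ {l | l ≠ j}, u l = false) →
      (fun l => xor (u l) (v l)) = if u j = true then Function.update v j true else v := by
    intro u hu
    funext l
    by_cases hl : l = j
    · subst hl
      cases h : u l <;> simp [hv]
    · rw [hu l hl]
      split_ifs <;> simp [hl]
  have h1 : ∀ u : DCube (s + 2), (¬ ∀ l ∈ {l | l ≠ j}, u l = false) →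
      (fun l => xor (u l) (v l)) ≠ v ∧ (fun l => xor (u l) (v l)) ≠ Function.update v j true := by
    intro u hu
    constructor <;> refine fun h => hu fun l hl => ?_
    · have := congrFun h l
      cases h : u l <;> simp_all
    · have := congrFun h l
      simp only [Function.update_of_ne (show l ≠ j from hl)] at this
      cases h : u l <;> simp_all
  have hswap : ∀ u : DCube (s + 2), (∀ l, l ≠ 0 → u (Equiv.swap 0 j l) = false) ↔
      ∀ l ∈ {l | l ≠ j}, u l = false := by
    intro u
    refine ⟨fun h l hl => ?_, fun h l hl => h _ fun h' => hl ?_⟩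
    · have := h (Equiv.swap 0 j l) (fun h' => hl (by
        rw [← Equiv.swap_apply_left 0 j] at h'
        have := congrArg (Equiv.swap 0 j) h'
        simpa using this))
      simpa using this
    · have := congrArg (Equiv.swap 0 j) h'
      simpa using this
  have key := hC.isCubeOn_replace {l | l ≠ j} (hC.isCubeOn_pair (q v) (q (Function.update v j true)) j)
    (IsCubeOn.comp h (IsLiteralMap.reindex (Equiv.swap 0 j))) (hq.comp hx)
    (q' := fun u => Function.update (Function.update q v y') (Function.update v j true) z'
      fun l => xor (u l) (v l))
    (fun u hu => by
      rw [h0 u hu]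
      split_ifs <;> rfl)
    (fun u hu => by
      rw [edgeMap_of_not_forall (by rwa [hswap]), Equiv.swap_apply_left])
    (fun u hu => by
      rw [h0 u hu, edgeMap_of_forall (by rwa [hswap]), Equiv.swap_apply_left]
      split_ifs
      · simp
      · rw [Function.update_of_ne hvw, Function.update_self])
    (fun u hu => by
      rw [Function.update_of_ne (h1 u hu).2, Function.update_of_ne (h1 u hu).1])
  simpa using key.comp hx

/-- Subtraction of displacements: reversing `h'` puts the edge `a, c` inside the facets `b'`, `d'`,
and `h` lets it be replaced by `b, d`. -/
theorem Parallel.cancel (hC : IsNilspace C) {a b b' c d d' : X} (h : Parallel C s a b c d)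
    (h' : Parallel C s a b' c d') : Parallel C s b' b d' d := by
  exact hC.isCubeOn_replace {j : Fin (s + 2) | j ≠ 0} (hC.isCubeOn_pair a c 0) h (h'.reverse hC)
    (fun v hv => (edgeMap_of_forall hv _ _ _ _).symm)
    (fun v hv => (edgeMap_of_not_forall hv _ _ _ _).symm)
    (fun v hv => (edgeMap_of_forall hv _ _ _ _).trans (edgeMap_of_forall hv _ _ _ _).symm)
    (fun v hv => (edgeMap_of_not_forall hv _ _ _ _).trans (edgeMap_of_not_forall hv _ _ _ _).symm)

/-- The discrepancy between `G` and `G'` is swept upwards edge by edge, with the same displacements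
applied to `Q`. Once only `1` remains, unique completion removes it. -/
theorem Parallel.isCubeOn_of_forall_mem (hC : IsStepNilspace C (s + 1))
    (A : Finset (DCube (s + 2))) (hA : IsUpperSet (A : Set (DCube (s + 2))))
    {G G' Q Q' : DCube (s + 2) → X} (hG : IsCubeOn C G) (hG' : IsCubeOn C G') (hQ : IsCubeOn C Q)
    (hGA : ∀ v, v ∉ A → G v = G' v) (h : ∀ v, Parallel C s (G v) (G' v) (Q v) (Q' v)) :
    IsCubeOn C Q' := by
  induction hm : A.card using Nat.strong_induction_on generalizing A G Q with
  | _ m ih =>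
    rcases (A.erase (DCube.one _)).eq_empty_or_nonempty with hA1 | hA1
    · have hGG : G = G' := hC.eq_of_eq_off_one hG hG' fun v hv => hGA v fun hvA => by
        have := Finset.mem_erase.2 ⟨hv, hvA⟩
        simp [hA1] at this
      subst hGG
      have : Q' = Q := funext fun v => (h v).unique hC (Parallel.refl hC.toIsNilspace _ _)
      rwa [this]
    · obtain ⟨v, hv⟩ := Finset.exists_minimal hA1
      obtain ⟨hv1, hvA⟩ := Finset.mem_erase.1 hv.1
      have hN := hC.toIsNilspace
      obtain ⟨j, hj⟩ : ∃ j, v j = false := by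
        by_contra! hcon
        exact hv1 (funext fun j => by simpa [DCube.one] using hcon j)
      set w := Function.update v j true with hw
      have hvw : v ≠ w := fun h => by
        have := congrFun h j
        simp [hw, hj] at this
      have hwA : w ∈ A := hA (show v ≤ w from fun l => by
        by_cases hl : l = j
        · subst hl; simp [hj]
        · simp [hw, hl]) hvA
      -- Correcting `v` displaces its upper neighbour `w` equally. This does no harm: `w` is still
      -- in `A`, where no agreement is required.
      obtain ⟨x, hx⟩ := Parallel.exists hN ((h v).charRel_left hN) (G w)
      obtain ⟨y, hy⟩ := Parallel.exists hN ((h v).charRel_left hN) (Q w)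
      refine ih (A.erase v).card (by rw [← hm]; exact Finset.card_erase_lt_of_mem hvA) (A.erase v)
        ?_ (hx.update_edge hN hG v j hj) (((h v).trans hN hy).update_edge hN hQ v j hj) ?_ ?_ rfl
      · intro a b hab ha
        simp only [Finset.coe_erase, Set.mem_sdiff, Finset.mem_coe, Set.mem_singleton_iff] at ha ⊢
        refine ⟨hA hab ha.1, ?_⟩
        rintro rfl
        refine ha.2 (hab.antisymm (hv.2 (Finset.mem_erase.2 ⟨?_, ha.1⟩) hab))
        rintro rfl
        exact hv1 (funext fun l => top_le_iff.1 (hab l))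
      · intro u hu
        have huw : u ≠ w := by
          rintro rfl
          exact hu (Finset.mem_erase.2 ⟨hvw.symm, hwA⟩)
        rw [Function.update_of_ne huw]
        by_cases huv : u = v
        · subst huv
          simp
        · rw [Function.update_of_ne huv]
          exact hGA u fun huA => hu (Finset.mem_erase.2 ⟨huv, huA⟩)
      · intro u
        by_cases huw : u = w
        · subst huw
          rw [Function.update_self, Function.update_self]
          exact (h _).cancel hN (hx.trans hN hy)
        · rw [Function.update_of_ne huw, Function.update_of_ne huw]
          by_cases huv : u = v
          · subst huv
            simp only [Function.update_self]
            exact Parallel.refl hN _ _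
          · rw [Function.update_of_ne huv, Function.update_of_ne huv]
            exact h u

/-- A map obtained from a cube `Q` by the displacements between two cubes `G`, `G'` is a cube. -/
theorem Parallel.isCubeOn [Fintype ι] (hC : IsStepNilspace C (s + 1)) {G G' Q Q' : (ι → Bool) → X}
    (hG : IsCubeOn C G) (hG' : IsCubeOn C G') (hQ : IsCubeOn C Q)
    (h : ∀ v, Parallel C s (G v) (G' v) (Q v) (Q' v)) : IsCubeOn C Q' :=
  hC.isCubeOn_of_forall_comp Q' fun _ hψ =>
    Parallel.isCubeOn_of_forall_mem hC Finset.univ (fun _ _ _ _ => by simp) (hG.comp hψ)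
      (hG'.comp hψ) (hQ.comp hψ) (fun v hv => by simp at hv) fun v => h _

end Parallel

/-! ### Construction of the lift -/

section Lift

variable {X ι : Type*} {C : CubeFamily X} {s : ℕ}

theorem Parallel.concat (hC : IsNilspace C) {a b c d e f : X} (h₁ : Parallel C s a b d e)
    (h₂ : Parallel C s b c e f) : Parallel C s a c d f :=
  h₂.cancel hC (h₁.reverse hC)

theorem Parallel.of_factorProj_eq (hC : IsNilspace C) {x x' : X}
    (h : factorProj C s x = factorProj C s x') : Parallel C s x x' x x' := by
  have := Quot.eqvGen_exact h
  clear h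
  induction this with
  | rel _ _ h => exact Parallel.of_charRel hC h
  | refl _ => exact Parallel.refl hC _ _
  | symm _ _ _ ih => exact ih.reverse hC
  | trans _ _ _ _ _ ih₁ ih₂ => exact ih₁.concat hC ih₂

theorem Parallel.of_charRel_transPairs (hC : IsNilspace C) {i : ℕ} (hi : 1 ≤ i)
    {α : Factor C s → Factor C s} {p p' : transPairs C s α}
    (h : charRel (transPairsCubes C s i α) s p p') :
    Parallel C s p.1.1 p'.1.1 p.1.2 p'.1.2 := by
  obtain ⟨r₀, h₀, r₁, h₁, rfl, rfl, h⟩ := h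
  -- Only the first of the `i` arrow coordinates stays free and the others are `1`, so the `i`-arrow
  -- restricts to a `1`-arrow.
  let ψ : DCube (s + 2) → DCube (s + 1 + i) := fun u =>
    Fin.append (fun j => u j.succ) (fun l => if (l : ℕ) = 0 then u 0 else true)
  have hψ : IsLiteralMap ψ := by
    intro j
    refine Fin.addCases (fun j => ?_) (fun l => ?_) j
    · simpa [ψ] using IsLiteral.var _
    · by_cases hl : (l : ℕ) = 0
      · simpa [ψ, hl] using IsLiteral.var _
      · simpa [ψ, hl] using IsLiteral.const _
  have hval : ∀ (r : DCube (s + 1) → transPairs C s α) (u : DCube (s + 2)),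
      arrow i (Prod.fst ∘ Subtype.val ∘ r) (Prod.snd ∘ Subtype.val ∘ r) (ψ u) =
      if u 0 = true then (r fun j => u j.succ).1.2 else (r fun j => u j.succ).1.1 := by
    intro r u
    have h1 : (fun j : Fin i => ψ u (Fin.natAdd (s + 1) j)) = DCube.one i ↔ u 0 = true := by
      constructor
      · intro h
        have := congrFun h ⟨0, hi⟩
        simp only [ψ, Fin.append_right] at this
        simpa [DCube.one] using this
      · intro h
        funext l
        simp [ψ, DCube.one, h]
    have h2 : (fun j : Fin (s + 1) => ψ u (Fin.castAdd i j)) = fun j => u j.succ := by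
      funext j
      simp [ψ]
    simp only [arrow, h1, h2, Function.comp_apply]
  have hz : ∀ u : DCube (s + 2), (∀ j, j ≠ 0 → u j = false) ↔
      (fun j : Fin (s + 1) => u j.succ) = DCube.zero _ := fun u =>
    ⟨fun h => funext fun j => h _ (Fin.succ_ne_zero j), fun h j hj => by
      obtain ⟨l, rfl⟩ := Fin.exists_succ_eq.2 hj
      exact congrFun h l⟩
  refine hC.isCubeOn_replace {j : Fin (s + 2) | j ≠ 0} ((hC.isCubeOn h₀).comp hψ)
    ((hC.isCubeOn h₁).comp hψ) (hC.isCubeOn_pair _ _ 0) ?_ ?_ ?_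
    (fun v hv => edgeMap_of_not_forall hv _ _ _ _)
  · intro v hv
    rw [hval, (hz v).1 hv]
  · intro v hv
    rw [hval, hval, h _ (fun h => hv ((hz v).2 h))]
  · intro v hv
    rw [hval, (hz v).1 hv, edgeMap_of_forall hv]

theorem Parallel.of_factorProj_transPairs_eq (hC : IsNilspace C) {i : ℕ} (hi : 1 ≤ i)
    {α : Factor C s → Factor C s} {p p' : transPairs C s α}
    (h : factorProj (transPairsCubes C s i α) s p = factorProj (transPairsCubes C s i α) s p') :
    Parallel C s p.1.1 p'.1.1 p.1.2 p'.1.2 := by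
  have := Quot.eqvGen_exact h
  clear h
  induction this with
  | rel _ _ h => exact Parallel.of_charRel_transPairs hC hi h
  | refl _ => exact Parallel.refl hC _ _
  | symm _ _ _ ih => exact ih.reverse hC
  | trans _ _ _ _ _ ih₁ ih₂ => exact ih₁.concat hC ih₂

/-- A map `β` which sends every cube `c` to the upper part of an `i`-arrow over `c` is a translation
of height `i`. -/
theorem IsNilspace.isTranslation_of_arrow (hC : IsNilspace C) {i : ℕ} {β : X → X}
    (h : ∀ n, ∀ c ∈ C n, arrow i c (β ∘ c) ∈ C (n + i)) : IsTranslation C i β := by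
  classical
  intro n I x hI q hq
  let e : Fin i ≃ I := (I.equivFinOfCardEq hI).symm
  -- The arrow coordinates record agreement with `x` on `I`; all are `1` exactly on the face.
  have hφ : IsLiteralMap fun v : DCube n =>
      (Fin.append v (fun l => !xor (v (e l)) (x (e l))) : DCube (n + i)) := by
    intro j
    refine Fin.addCases (fun j => ?_) (fun l => ?_) j
    · simpa using IsLiteral.var _
    · simpa only [Fin.append_right] using ((IsLiteral.var _).xor_const _).not
  convert ((hC.isCubeOn (h n q hq)).comp hφ).mem using 1
  funext v
  have h1 : (fun l : Fin i => (Fin.append v (fun l => !xor (v (e l)) (x (e l))) : DCube (n + i))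
      (Fin.natAdd n l)) = DCube.one i ↔ v ∈ DCube.face I x := by
    constructor
    · intro h j hj
      have := congrFun h (e.symm ⟨j, hj⟩)
      simpa [DCube.one] using this
    · intro h
      funext l
      simp [DCube.one, h _ (e l).2]
  simp only [applyOn, arrow, Function.comp_apply, Fin.append_left]
  split_ifs <;> simp_all

/-- A translation of the factor `F_s(X)` lifts to `X` if its translation bundle is split. -/
theorem IsStepNilspace.exists_isTranslationLift (hC : IsStepNilspace C (s + 1)) {i : ℕ} (hi : 1 ≤ i)
    {α : Factor C s → Factor C s}
    (hsplit : IsSplitProj (factorCubes C s) (transBundleCubes C s i α)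
      (transBundleMap C hC.toIsNilspace s i hi α)) :
    ∃ β : X → X, IsTranslationLift C s i α β := by
  have hN := hC.toIsNilspace
  obtain ⟨m, hm, hmid⟩ := hsplit
  choose p hp using fun y => Quot.exists_rep (m y)
  have hproj : ∀ y, factorProj C s (p y).1.1 = y := fun y => by
    have := congrFun hmid y
    rwa [Function.comp_apply, ← hp y] at this
  choose β hβ using fun x => Parallel.exists hN
    ((Parallel.of_factorProj_eq hN (hproj (factorProj C s x))).charRel_left hN)
    (p (factorProj C s x)).1.2
  refine ⟨β, hN.isTranslation_of_arrow fun n c hc => ?_, fun x => ?_⟩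
  · obtain ⟨r, hr, hrm⟩ := hm n (factorProj C s ∘ c) ⟨c, hc, rfl⟩
    have hpar : ∀ v, Parallel C s (r v).1.1 (c v) (r v).1.2 (β (c v)) := fun v => by
      -- The chosen representatives need not form a cube; they are exchanged for `r`, which does.
      have h1 : factorProj (transPairsCubes C s i α) s (p (factorProj C s (c v))) =
          factorProj (transPairsCubes C s i α) s (r v) := (hp _).trans (congrFun hrm v)
      exact (Parallel.of_factorProj_transPairs_eq hN hi h1).cancel hN (hβ (c v)) |>.reverse hN
    have hl : IsLiteralMap fun (u : DCube (n + i)) => (fun j => u (Fin.castAdd i j) : DCube n) :=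
      IsLiteralMap.reindex _
    -- The cubes `r.1` and `c`, pulled back along the arrow coordinates, supply the displacements
    -- that are applied to the arrow of `r`.
    refine (Parallel.isCubeOn hC
      ((hN.isCubeOn (fst_mem_of_mem_arrowCubes hN hi hr)).comp hl)
      ((hN.isCubeOn hc).comp hl) (hN.isCubeOn hr) fun u => ?_).mem
    simp only [arrow, Function.comp_apply]
    split_ifs
    · exact hpar _
    · exact Parallel.of_charRel hN ((hpar _).charRel_left hN)
  · have h1 : factorProj C s (p (factorProj C s x)).1.2 = factorProj C s (β x) :=
      Quot.sound ((hβ x).charRel_right hN)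
    rw [← h1, ← (p (factorProj C s x)).2, hproj]

end Lift

theorem proposition3p3p30 {X : Type*} (C : CubeFamily X) (k i : ℕ) (hk : 1 ≤ k) (hi : 1 ≤ i)
    (hC : IsStepNilspace C k)
    (α : Factor C (k - 1) → Factor C (k - 1))
    (hα : IsTranslation (factorCubes C (k - 1)) i α)
    (hsplit : IsSplitProj (factorCubes C (k - 1)) (transBundleCubes C (k - 1) i α)
      (transBundleMap C hC.toIsNilspace (k - 1) i hi α)) :
    ∃ β : X → X, IsTranslationLift C (k - 1) i α β := by
  obtain ⟨s, rfl⟩ : ∃ s, k = s + 1 := ⟨k - 1, by omega⟩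
  exact hC.exists_isTranslationLift hi hsplit
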